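/- Let $d\ge 1$. For $a>0$ let $N_{d,a}\subset\mathbb{C}$ be the open ellipse with foci $0$ and $d$ and leftmost point $-a$. For $\rho>1$, $F>0$ and $h=(\rho-\rho^{-1})/2$ let $\mathcal{A}^d(\rho,F)$ be the set of functions $f:[0,1]^d\to\mathbb{R}$ that can be analytically continued to the region $\{z\in\mathbb{C}^d: z_1^2+\dots+z_d^2\in N_{d,h^2}\}$ with the continuation bounded there by $F$ in absolute value. A network with $L$ hidden layers, width vector $p=(p_0,\dots,p_{L+1})$, $p_0=d+1$, $p_{L+1}=1$, and absolute value activation $a(t)=|t|$ is given by real $p_{i+1}\times p_i$ matrices $W_i$, $i=0,\dots,L$. It computes $y\mapsto W_L\circ a\circ W_{L-1}\circ a\circ\dots\circ a\circ W_0\,y$ on $\mathbb{R}^{d+1}$, where $a$ acts coordinatewise. Let $\|\cdot\|_\times$ of the network be the $l_1$ norm of the row vector $|W_L|\,|W_{L-1}|\cdots|W_0|$, where $|W|$ is the matrix of absolute values of the entries of $W$. There are constants $K_1,K_2$ depending only on $d$ such that for all $\rho\ge 2^{\sqrt d}$ and $F>0$ there are constants $C,K_3$ depending only on $d,\rho,F$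 with the following property. For every $f\in\mathcal{A}^d(\rho,F)$ and every $\varepsilon\in(0,1)$ there is such a network $F_\varepsilon$ with $$|F_\varepsilon(1,x)-f(x)|\le C\varepsilon\quad\text{for all }x\in[0,1]^d,$$ and, writing $\ell_\varepsilon=\max\{1,\log_2\tfrac1\varepsilon\}$ (so that $\ell_\varepsilon=\log_2\tfrac1\varepsilon$ for $\varepsilon\le\tfrac12$), $$L\le K_1\,\ell_\varepsilon^{2},\qquad \|p\|_\infty=\max_{0\le i\le L+1}p_i\le K_2\,\ell_\varepsilon^{d+2},\qquad \|F_\varepsilon\|_\times\le K_3\,\ell_\varepsilon^{2d+5}.$$ -/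

import Mathlib

/-- Feed-forward neural networks without shift vectors, with `n` inputs and `m` outputs.
`Network.output W` is the linear map `x ↦ W x` (no hidden layer); `Network.hidden W N` first
multiplies by `W`, then applies the activation function coordinatewise (one hidden layer of
width `k`), and then runs `N`. Thus a network is a sequence of matrices `W_0, ..., W_L` with
`W_i` of size `p_{i+1} × p_i`, `p_0 = n`, `p_{L+1} = m`. -/
inductive Network : ℕ → ℕ → Type
  | output {n m : ℕ} (W : Matrix (Fin m) (Fin n) ℝ) : Network n m
  | hidden {n k m : ℕ} (W : Matrix (Fin k) (Fin n) ℝ) (N : Network k m) : Network n m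

namespace Network

/-- The function `x ↦ W_L ∘ α ∘ W_{L-1} ∘ α ∘ ... ∘ α ∘ W_0 x` computed by the network with
activation function `α`, which acts element-wise. -/
noncomputable def eval (α : ℝ → ℝ) : {n m : ℕ} → Network n m → (Fin n → ℝ) → (Fin m → ℝ)
  | _, _, output W, x => W.mulVec x
  | _, _, hidden W N, x => N.eval α (fun i => α (W.mulVec x i))

/-- The depth `L`: the number of hidden layers. -/
def depth : {n m : ℕ} → Network n m → ℕ
  | _, _, output _ => 0
  | _, _, hidden _ N => N.depth + 1

/-- The maximum norm `‖p‖_∞` of the width vector `p = (p_0, p_1, ..., p_{L+1})`. -/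
def maxWidth : {n m : ℕ} → Network n m → ℕ
  | n, m, output _ => max n m
  | n, _, hidden _ N => max n N.maxWidth

/-- The product `|W_L| ⬝ |W_{L-1}| ⬝ ... ⬝ |W_0|` of the entrywise absolute values of the weight
matrices. -/
noncomputable def absProd : {n m : ℕ} → Network n m → Matrix (Fin m) (Fin n) ℝ
  | _, _, output W => W.map (fun t => |t|)
  | _, _, hidden W N => N.absProd * W.map (fun t => |t|)

/-- `‖·‖_×` of a network with one output: the `l_1` norm of the row vector `∏ |W_i|`. -/
noncomputable def crossNorm {n : ℕ} (N : Network n 1) : ℝ :=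
  ∑ j, |N.absProd 0 j|

end Network

/-- The open ellipse in `ℂ` with foci `0` and `d` and leftmost point `-a` (for `d, a > 0`): the sum
of the distances to the foci is smaller than its value `a + (a + d)` at `-a`. -/
def openEllipse (d a : ℝ) : Set ℂ :=
  {w : ℂ | ‖w‖ + ‖w - (d : ℂ)‖ < d + 2 * a}

/-- The region `{z ∈ ℂ^d : z_1² + ... + z_d² ∈ N_{d, h²}}` with `h = (ρ - ρ⁻¹) / 2`. -/
def analyticRegion (d : ℕ) (ρ : ℝ) : Set (Fin d → ℂ) :=
  {z | ∑ i, z i ^ 2 ∈ openEllipse (d : ℝ) (((ρ - ρ⁻¹) / 2) ^ 2)}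

/-- The class `𝒜^d(ρ, F)` of real functions on `[0,1]^d` (values elsewhere are irrelevant) that
have an analytic continuation to `analyticRegion d ρ` which is bounded there by `F`. -/
def AnalyticClass (d : ℕ) (ρ F : ℝ) : Set ((Fin d → ℝ) → ℝ) :=
  {f | ∃ g : (Fin d → ℂ) → ℂ,
    AnalyticOnNhd ℂ g (analyticRegion d ρ) ∧
    (∀ z ∈ analyticRegion d ρ, ‖g z‖ ≤ F) ∧
    ∀ x ∈ Set.Icc (0 : Fin d → ℝ) 1, g (fun i => (x i : ℂ)) = (f x : ℂ)}

/-! After `x = (1 + u) / 2`, the hypothesis `ρ ≥ 2 ^ √d` puts the polydisc `|u_i| < 9/8` inside the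
region of analyticity (`half_add_mem_analyticRegion`). Interpolation at `n`-th roots of unity, one
variable at a time, then gives a polynomial in the `2 x_i - 1` whose coefficients are bounded by `F`
and whose error on the cube is a power of `n` times `(10/11) ^ n` (`exists_polynomial_approx`).

A network evaluates all `n ^ d` monomials in parallel. Each is padded with ones to a product of `2 ^
q ≥ d n` factors and computed by a binary tree (`Realizes.prod_approx`). Its nodes use `xy =
((x+y)/2)² - ((x-y)/2)²`, with squares approximated by sums of iterated tent functions. All
intermediate values stay in `[-1, 1]`, so errors only add up. One tree level multiplies the row sums
of `|W_L| ⋯ |W_0|` by about `4`, so the tree costs `4 ^ q`, quadratic in `n`. Finally `n` and the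
number of tent iterations are taken proportional to `log (1/ε)`. -/

namespace Network

/-! ### Composition of networks and of their weight bounds -/

/-- Append an activation layer followed by the linear map `V`. -/
def snoc : {n k m : ℕ} → Network n k → Matrix (Fin m) (Fin k) ℝ → Network n m
  | _, _, _, output W, V => hidden W (output V)
  | _, _, _, hidden W N, V => hidden W (N.snoc V)

/-- Compose the last linear map of a network with `V`. -/
noncomputable def postcomp :
    {n k m : ℕ} → Network n k → Matrix (Fin m) (Fin k) ℝ → Network n m
  | _, _, _, output W, V => output (V * W)
  | _, _, _, hidden W N, V => hidden W (N.postcomp V)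

theorem eval_snoc (α : ℝ → ℝ) {n k m : ℕ} (N : Network n k) (V : Matrix (Fin m) (Fin k) ℝ)
    (x : Fin n → ℝ) : (N.snoc V).eval α x = V.mulVec (fun i => α (N.eval α x i)) := by
  induction N with
  | output W => rfl
  | hidden W N ih => exact ih V _

theorem eval_postcomp (α : ℝ → ℝ) {n k m : ℕ} (N : Network n k) (V : Matrix (Fin m) (Fin k) ℝ)
    (x : Fin n → ℝ) : (N.postcomp V).eval α x = V.mulVec (N.eval α x) := by
  induction N with
  | output W => simp [postcomp, eval]
  | hidden W N ih => exact ih V _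

theorem depth_snoc {n k m : ℕ} (N : Network n k) (V : Matrix (Fin m) (Fin k) ℝ) :
    (N.snoc V).depth = N.depth + 1 := by
  induction N with
  | output W => rfl
  | hidden W N ih => exact congrArg (· + 1) (ih V)

theorem depth_postcomp {n k m : ℕ} (N : Network n k) (V : Matrix (Fin m) (Fin k) ℝ) :
    (N.postcomp V).depth = N.depth := by
  induction N with
  | output W => rfl
  | hidden W N ih => exact congrArg (· + 1) (ih V)

theorem maxWidth_snoc_le {n k m : ℕ} (N : Network n k) (V : Matrix (Fin m) (Fin k) ℝ) :
    (N.snoc V).maxWidth ≤ max N.maxWidth m := by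
  induction N with
  | output W => simp [snoc, maxWidth]
  | hidden W N ih =>
    have := ih V
    simp only [snoc, maxWidth]
    omega

theorem maxWidth_postcomp_le {n k m : ℕ} (N : Network n k) (V : Matrix (Fin m) (Fin k) ℝ) :
    (N.postcomp V).maxWidth ≤ max N.maxWidth m := by
  induction N with
  | output W =>
    simp only [postcomp, maxWidth]
    omega
  | hidden W N ih =>
    have := ih V
    simp only [postcomp, maxWidth]
    omega

theorem absProd_nonneg {n k : ℕ} (N : Network n k) (i : Fin k) (j : Fin n) :
    0 ≤ N.absProd i j := by
  induction N with
  | output W => exact abs_nonneg _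
  | hidden W N ih =>
    rw [absProd, Matrix.mul_apply]
    exact Finset.sum_nonneg fun l _ => mul_nonneg (ih _ _) (abs_nonneg _)

theorem absProd_snoc {n k m : ℕ} (N : Network n k) (V : Matrix (Fin m) (Fin k) ℝ) :
    (N.snoc V).absProd = V.map (fun t => |t|) * N.absProd := by
  induction N with
  | output W => rfl
  | hidden W N ih =>
    simp only [snoc, absProd, ih, Matrix.mul_assoc]

/-- Only an inequality, since entries may cancel in the merged matrix `V * W`. -/
theorem absProd_postcomp_le {n k m : ℕ} (N : Network n k) (V : Matrix (Fin m) (Fin k) ℝ)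
    (i : Fin m) (j : Fin n) :
    (N.postcomp V).absProd i j ≤ (V.map (fun t => |t|) * N.absProd) i j := by
  induction N with
  | output W =>
    simp only [postcomp, absProd, Matrix.map_apply, Matrix.mul_apply]
    exact (Finset.abs_sum_le_sum_abs _ _).trans_eq (by simp [abs_mul])
  | hidden W N ih =>
    simp only [postcomp, absProd]
    rw [← Matrix.mul_assoc, Matrix.mul_apply, Matrix.mul_apply]
    exact Finset.sum_le_sum fun l _ => mul_le_mul_of_nonneg_right (ih V l) (abs_nonneg _)

theorem crossNorm_eq {n : ℕ} (N : Network n 1) : N.crossNorm = ∑ j, N.absProd 0 j :=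
  Finset.sum_congr rfl fun _ _ => abs_of_nonneg (N.absProd_nonneg _ _)

/-- The family `H` is computed on `S` by an absolute value network of depth `L` and maximal width
at most `w`, whose `|W_L| ⋯ |W_0|` has row sums at most `B`. -/
def Realizes {n : ℕ} (S : Set (Fin n → ℝ)) (L w : ℕ) {ι : Type} [Fintype ι]
    (H : ι → (Fin n → ℝ) → ℝ) (B : ι → ℝ) : Prop :=
  ∃ (k : ℕ) (e : ι ≃ Fin k) (N : Network n k), N.depth = L ∧ N.maxWidth ≤ w ∧
    (∀ x ∈ S, ∀ i, N.eval (fun t => |t|) x (e i) = H i x) ∧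
    ∀ i, ∑ j, N.absProd (e i) j ≤ B i

section Realizes

variable {n : ℕ} {S : Set (Fin n → ℝ)} {L w : ℕ} {ι κ : Type} [Fintype ι] [Fintype κ]
  {H : ι → (Fin n → ℝ) → ℝ} {B : ι → ℝ}

theorem Realizes.mono (h : Realizes S L w H B) {L' w' : ℕ} {H' : ι → (Fin n → ℝ) → ℝ}
    {B' : ι → ℝ} (hL : L = L') (hw : w ≤ w') (hH : ∀ x ∈ S, ∀ i, H i x = H' i x)
    (hB : ∀ i, B i ≤ B' i) : Realizes S L' w' H' B' := by
  obtain ⟨k, e, N, h1, h2, h3, h4⟩ := h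
  exact ⟨k, e, N, h1.trans hL, h2.trans hw, fun x hx i => (h3 x hx i).trans (hH x hx i),
    fun i => (h4 i).trans (hB i)⟩

theorem Realizes.input (S : Set (Fin n → ℝ)) (W : κ → Fin n → ℝ) :
    Realizes S 0 (max n (Fintype.card κ)) (fun k x => ∑ j, W k j * x j)
      (fun k => ∑ j, |W k j|) :=
  ⟨_, Fintype.equivFin κ, output (Matrix.of fun a j => W ((Fintype.equivFin κ).symm a) j), rfl,
    le_rfl, fun x _ i => by simp [eval, Matrix.mulVec, dotProduct], fun i => by simp [absProd]⟩

theorem sum_mul_absProd_le {k m : ℕ} (V : Matrix (Fin m) (Fin k) ℝ) (N : Network n k)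
    (e : ι ≃ Fin k) (hB : ∀ i, ∑ j, N.absProd (e i) j ≤ B i) (a : Fin m) :
    ∑ j, (V.map (fun t => |t|) * N.absProd) a j ≤ ∑ i, |V a (e i)| * B i := by
  simp only [Matrix.mul_apply, Matrix.map_apply]
  rw [Finset.sum_comm, ← e.sum_comp]
  refine Finset.sum_le_sum fun i _ => ?_
  rw [← Finset.mul_sum]
  exact mul_le_mul_of_nonneg_left (hB i) (abs_nonneg _)

theorem Realizes.linear (h : Realizes S L w H B) (W : κ → ι → ℝ) :
    Realizes S L (max w (Fintype.card κ)) (fun k x => ∑ i, W k i * H i x)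
      (fun k => ∑ i, |W k i| * B i) := by
  obtain ⟨k, e, N, h1, h2, h3, h4⟩ := h
  let f := Fintype.equivFin κ
  let V : Matrix (Fin (Fintype.card κ)) (Fin k) ℝ := Matrix.of fun a b => W (f.symm a) (e.symm b)
  refine ⟨_, f, N.postcomp V, (N.depth_postcomp V).trans h1,
    (N.maxWidth_postcomp_le V).trans (max_le_max_right _ h2), fun x hx i => ?_, fun i => ?_⟩
  · rw [eval_postcomp, Matrix.mulVec, dotProduct, ← e.sum_comp]
    exact Finset.sum_congr rfl fun j _ => by rw [h3 x hx]; simp [V]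
  · refine (Finset.sum_le_sum fun j _ => N.absProd_postcomp_le V _ j).trans ?_
    exact (sum_mul_absProd_le V N e h4 (f i)).trans_eq (by simp [V])

theorem Realizes.abs_linear (h : Realizes S L w H B) (W : κ → ι → ℝ) :
    Realizes S (L + 1) (max w (Fintype.card κ)) (fun k x => ∑ i, W k i * |H i x|)
      (fun k => ∑ i, |W k i| * B i) := by
  obtain ⟨k, e, N, h1, h2, h3, h4⟩ := h
  let f := Fintype.equivFin κ
  let V : Matrix (Fin (Fintype.card κ)) (Fin k) ℝ := Matrix.of fun a b => W (f.symm a) (e.symm b)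
  refine ⟨_, f, N.snoc V, (N.depth_snoc V).trans (by rw [h1]),
    (N.maxWidth_snoc_le V).trans (max_le_max_right _ h2), fun x hx i => ?_, fun i => ?_⟩
  · rw [eval_snoc, Matrix.mulVec, dotProduct, ← e.sum_comp]
    exact Finset.sum_congr rfl fun j _ => by rw [h3 x hx]; simp [V]
  · rw [absProd_snoc]
    exact (sum_mul_absProd_le V N e h4 (f i)).trans_eq (by simp [V])

theorem Realizes.exists_network {H : Unit → (Fin n → ℝ) → ℝ} {B : Unit → ℝ}
    (h : Realizes S L w H B) : ∃ N : Network n 1, N.depth = L ∧ N.maxWidth ≤ w ∧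
      (∀ x ∈ S, N.eval (fun t => |t|) x 0 = H () x) ∧ N.crossNorm ≤ B () := by
  obtain ⟨k, e, N, h1, h2, h3, h4⟩ := h
  obtain rfl : 1 = k := by simpa using Fintype.card_congr e
  refine ⟨N, h1, h2, fun x hx => ?_, ?_⟩
  · rw [← h3 x hx (), Subsingleton.elim (e ()) 0]
  · rw [crossNorm_eq, ← Subsingleton.elim (e ()) 0]
    exact h4 ()

end Realizes

end Network

/-! ### Piecewise linear squares and products -/

/-- Iterates of `s ↦ |2s - 1|`. -/
noncomputable def tentIter (s : ℝ) : ℕ → ℝ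
  | 0 => s
  | t + 1 => |2 * tentIter s t - 1|

/-- Piecewise linear approximation of the square on `[0, 1]`. -/
noncomputable def sqApprox (s : ℝ) : ℕ → ℝ
  | 0 => s
  | t + 1 => sqApprox s t - (1 / 4) ^ (t + 1) + (1 / 4) ^ (t + 1) * tentIter s (t + 1)

/-- Piecewise linear approximation of the product on `[-1, 1]²`. -/
noncomputable def mulApprox (m : ℕ) (x y : ℝ) : ℝ :=
  sqApprox |(x + y) / 2| m - sqApprox |(x - y) / 2| m

section sqApprox

variable {s : ℝ}

theorem tentIter_nonneg (h0 : 0 ≤ s) (t : ℕ) : 0 ≤ tentIter s t := by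
  cases t with
  | zero => exact h0
  | succ t => exact abs_nonneg _

theorem tentIter_le_one (h0 : 0 ≤ s) (h1 : s ≤ 1) (t : ℕ) : tentIter s t ≤ 1 := by
  induction t with
  | zero => exact h1
  | succ t ih =>
    have := tentIter_nonneg h0 t
    exact abs_le.2 ⟨by linarith, by linarith⟩

/-- If `T' = |2T - 1|`, then `T - T² = (1 - T'²) / 4`; each iteration thus gains a factor `1/4` in
the error. -/
theorem sqApprox_eq (s : ℝ) (t : ℕ) :
    sqApprox s t = s ^ 2 + (1 / 4) ^ t * (tentIter s t - tentIter s t ^ 2) := by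
  induction t with
  | zero => simp [sqApprox, tentIter]
  | succ t ih =>
    have h : tentIter s (t + 1) ^ 2 = (2 * tentIter s t - 1) ^ 2 := sq_abs _
    rw [sqApprox, ih, h]
    ring

theorem sq_le_sqApprox (h0 : 0 ≤ s) (h1 : s ≤ 1) (t : ℕ) : s ^ 2 ≤ sqApprox s t := by
  rw [sqApprox_eq]
  have h2 := tentIter_nonneg h0 t
  have h3 := tentIter_le_one h0 h1 t
  have : 0 ≤ (1 / 4 : ℝ) ^ t * (tentIter s t - tentIter s t ^ 2) :=
    mul_nonneg (by positivity) (by nlinarith)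
  linarith

theorem sqApprox_le (h0 : 0 ≤ s) (h1 : s ≤ 1) (t : ℕ) : sqApprox s t ≤ s ^ 2 + (1 / 4) ^ t := by
  rw [sqApprox_eq]
  have h2 := tentIter_nonneg h0 t
  have h3 := tentIter_le_one h0 h1 t
  have : (1 / 4 : ℝ) ^ t * (tentIter s t - tentIter s t ^ 2) ≤ (1 / 4) ^ t * 1 :=
    mul_le_mul_of_nonneg_left (by nlinarith) (by positivity)
  linarith

theorem sqApprox_nonneg (h0 : 0 ≤ s) (h1 : s ≤ 1) (t : ℕ) : 0 ≤ sqApprox s t :=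
  (sq_nonneg s).trans (sq_le_sqApprox h0 h1 t)

/-- The approximations decrease from `s`. The sharp bound `1`, without an error term, keeps
approximate products in `[-1, 1]`, ready for the next tree level. -/
theorem sqApprox_le_one (h0 : 0 ≤ s) (h1 : s ≤ 1) (t : ℕ) : sqApprox s t ≤ 1 := by
  induction t with
  | zero => exact h1
  | succ t ih =>
    have h3 := tentIter_le_one h0 h1 (t + 1)
    have : (1 / 4 : ℝ) ^ (t + 1) * tentIter s (t + 1) ≤ (1 / 4) ^ (t + 1) * 1 :=
      mul_le_mul_of_nonneg_left h3 (by positivity)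
    rw [sqApprox]
    linarith

theorem abs_half_add_le {x y : ℝ} (hx : |x| ≤ 1) (hy : |y| ≤ 1) : |(x + y) / 2| ≤ 1 := by
  rw [abs_le] at *
  constructor <;> linarith

theorem abs_half_sub_le {x y : ℝ} (hx : |x| ≤ 1) (hy : |y| ≤ 1) : |(x - y) / 2| ≤ 1 := by
  rw [abs_le] at *
  constructor <;> linarith

theorem abs_mulApprox_le {x y : ℝ} (hx : |x| ≤ 1) (hy : |y| ≤ 1) (m : ℕ) :
    |mulApprox m x y| ≤ 1 := by
  have h1 := sqApprox_nonneg (abs_nonneg _) (abs_half_add_le hx hy) m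
  have h2 := sqApprox_nonneg (abs_nonneg _) (abs_half_sub_le hx hy) m
  have h3 := sqApprox_le_one (abs_nonneg _) (abs_half_add_le hx hy) m
  have h4 := sqApprox_le_one (abs_nonneg _) (abs_half_sub_le hx hy) m
  rw [mulApprox, abs_le]
  constructor <;> linarith

/-- Both squaring errors lie in `[0, 4⁻ᵐ]`, so their difference costs no factor `2`. -/
theorem abs_mulApprox_sub_le {x y : ℝ} (hx : |x| ≤ 1) (hy : |y| ≤ 1) (m : ℕ) :
    |mulApprox m x y - x * y| ≤ (1 / 4) ^ m := by
  have h1 := sq_le_sqApprox (abs_nonneg _) (abs_half_add_le hx hy) m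
  have h2 := sq_le_sqApprox (abs_nonneg _) (abs_half_sub_le hx hy) m
  have h3 := sqApprox_le (abs_nonneg _) (abs_half_add_le hx hy) m
  have h4 := sqApprox_le (abs_nonneg _) (abs_half_sub_le hx hy) m
  rw [sq_abs] at h1 h2 h3 h4
  rw [mulApprox, abs_le]
  constructor <;> nlinarith

end sqApprox

theorem abs_prod_sub_prod_le {ι : Type*} (s : Finset ι) {f g : ι → ℝ} (hf : ∀ i ∈ s, |f i| ≤ 1)
    (hg : ∀ i ∈ s, |g i| ≤ 1) : |∏ i ∈ s, f i - ∏ i ∈ s, g i| ≤ ∑ i ∈ s, |f i - g i| := by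
  classical
  induction s using Finset.induction_on with
  | empty => simp
  | insert a s ha ih =>
    rw [Finset.prod_insert ha, Finset.prod_insert ha, Finset.sum_insert ha]
    have h1 := ih (fun i hi => hf i (Finset.mem_insert_of_mem hi))
      fun i hi => hg i (Finset.mem_insert_of_mem hi)
    have h2 : |∏ i ∈ s, f i| ≤ 1 := by
      rw [Finset.abs_prod]
      exact Finset.prod_le_one (fun _ _ => abs_nonneg _)
        fun i hi => hf i (Finset.mem_insert_of_mem hi)
    calc _ = |(f a - g a) * ∏ i ∈ s, f i + g a * (∏ i ∈ s, f i - ∏ i ∈ s, g i)| := by ring_nf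
      _ ≤ |f a - g a| * |∏ i ∈ s, f i| + |g a| * |∏ i ∈ s, f i - ∏ i ∈ s, g i| := by
          rw [← abs_mul, ← abs_mul]
          exact abs_add_le _ _
      _ ≤ |f a - g a| * 1 + 1 * ∑ i ∈ s, |f i - g i| :=
          add_le_add (mul_le_mul_of_nonneg_left h2 (abs_nonneg _))
            (mul_le_mul (hg a (Finset.mem_insert_self _ _)) h1 (abs_nonneg _) zero_le_one)
      _ = _ := by ring

/-! ### Networks for squares, products and product trees -/

namespace Network

/-- Adjoin the constant function `1` to a family of functions. -/
def withOne {X κ : Type} (v : κ → X → ℝ) : Option κ → X → ℝ := fun o x => o.elim 1 fun k => v k x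

/-- The bound `1` for the constant function and `b` for all others. -/
def boundOne {κ : Type} (b : ℝ) : Option κ → ℝ := fun o => o.elim 1 fun _ => b

section

variable {n : ℕ} {S : Set (Fin n → ℝ)} {L w : ℕ} {ι κ : Type} [Fintype ι] [Fintype κ]

/-- The activation turns `2T - 1` into the next tent iterate and leaves the constant `1` and the
nonnegative partial sums unchanged. Tent weights double per layer but enter the sums with factor
`4^{-(t+1)}`, so the row sums of the squares stay below `2b + 1`. -/
theorem Realizes.square_stage {v : κ → (Fin n → ℝ) → ℝ} {b : ℝ}
    (h : Realizes S L w (withOne v) (boundOne b)) (hv : ∀ x ∈ S, ∀ k, |v k x| ≤ 1) (t : ℕ) :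
    Realizes S (L + (t + 1)) (max w (1 + 2 * Fintype.card κ))
      (withOne (Sum.elim (fun k x => 2 * tentIter |v k x| t - 1) fun k x => sqApprox |v k x| t))
      (fun o => o.elim 1 (Sum.elim (fun _ => 2 ^ (t + 1) * (b + 1) - 1)
        fun _ => b + (b + 1) * (1 - (1 / 2) ^ t))) := by
  classical
  induction t with
  | zero =>
    refine (h.abs_linear (κ := Option (κ ⊕ κ)) (fun o i => o.elim (i.elim 1 fun _ => 0)
      (Sum.elim (fun k => i.elim (-1) fun j => if j = k then 2 else 0)
        (fun k => i.elim 0 fun j => if j = k then 1 else 0)))).mono rfl ?_ ?_ ?_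
    · simp only [Fintype.card_option, Fintype.card_sum]
      omega
    · rintro x - (_ | k | k)
      · simp [Fintype.sum_option, withOne]
      · simp [Fintype.sum_option, withOne, tentIter]
        ring
      · simp [Fintype.sum_option, withOne, sqApprox]
    · rintro (_ | k | k)
      · simp [Fintype.sum_option, boundOne]
      · simp [Fintype.sum_option, boundOne, apply_ite abs]
        linarith
      · simp [Fintype.sum_option, boundOne, apply_ite abs]
  | succ t ih =>
    refine (ih.abs_linear (κ := Option (κ ⊕ κ)) (fun o i => o.elim (i.elim 1 fun _ => 0)
      (Sum.elim (fun k => i.elim (-1) (Sum.elim (fun j => if j = k then 2 else 0) fun _ => 0))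
        (fun k => i.elim (-(1 / 4) ^ (t + 1)) (Sum.elim
          (fun j => if j = k then (1 / 4) ^ (t + 1) else 0)
          (fun j => if j = k then 1 else 0)))))).mono rfl ?_ ?_ ?_
    · simp only [Fintype.card_option, Fintype.card_sum]
      omega
    · rintro x hx (_ | k | k)
      · simp [Fintype.sum_option, withOne]
      · simp [Fintype.sum_option, withOne, tentIter]
        ring
      · have := sqApprox_nonneg (abs_nonneg _) (hv x hx k) t
        simp [Fintype.sum_option, withOne, sqApprox, tentIter, abs_of_nonneg this]
        ring
    · rintro (_ | k | k)
      · simp [Fintype.sum_option]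
      · simp [Fintype.sum_option, apply_ite abs]
        apply le_of_eq
        ring
      · have h4 : (1 / 4 : ℝ) ^ (t + 1) * 2 ^ (t + 1) = (1 / 2) ^ (t + 1) := by
          rw [← mul_pow]
          norm_num
        simp only [Fintype.sum_option, Fintype.sum_sum_type, Option.elim_none, Option.elim_some,
          Sum.elim_inl, Sum.elim_inr, apply_ite abs, ite_mul, abs_neg, abs_zero, zero_mul,
          Finset.sum_ite_eq', Finset.mem_univ, if_true, abs_one, abs_pow, mul_one, one_mul]
        rw [abs_of_pos (by norm_num : (0 : ℝ) < 1 / 4), mul_sub, ← mul_assoc, h4]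
        apply le_of_eq
        ring

theorem Realizes.mul_approx {v : ι → (Fin n → ℝ) → ℝ} {b : ℝ} (hb : 0 ≤ b)
    (h : Realizes S L w (withOne v) (boundOne b)) (hv : ∀ x ∈ S, ∀ k, |v k x| ≤ 1)
    (a c : κ → ι) (m : ℕ) :
    Realizes S (L + (m + 1)) (max w (1 + 4 * Fintype.card κ))
      (withOne fun k x => mulApprox m (v (a k) x) (v (c k) x)) (boundOne (4 * b + 2)) := by
  classical
  have h1 : Realizes S L (max w (1 + 2 * Fintype.card κ))
      (withOne fun (k : κ × Bool) x =>
        if k.2 then (v (a k.1) x + v (c k.1) x) / 2 else (v (a k.1) x - v (c k.1) x) / 2)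
      (boundOne b) := by
    refine (h.linear (κ := Option (κ × Bool)) (fun o i => o.elim (i.elim 1 fun _ => 0)
      (fun k => i.elim 0 fun j => (if j = a k.1 then 1 / 2 else 0) +
        (if j = c k.1 then (if k.2 then 1 / 2 else -(1 / 2)) else 0)))).mono rfl ?_ ?_ ?_
    · simp only [Fintype.card_option, Fintype.card_prod, Fintype.card_bool]
      omega
    · rintro x - (_ | ⟨k, β⟩)
      · simp [Fintype.sum_option, withOne]
      · cases β <;> simp [Fintype.sum_option, withOne, add_mul, Finset.sum_add_distrib] <;> ring
    · rintro (_ | ⟨k, β⟩)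
      · simp [Fintype.sum_option, boundOne]
      · simp only [Fintype.sum_option, boundOne, Option.elim_none, Option.elim_some, abs_zero,
          zero_mul, zero_add]
        calc _ ≤ ∑ j, ((if j = a k then 1 / 2 * b else 0) + (if j = c k then 1 / 2 * b else 0)) := by
              refine Finset.sum_le_sum fun j _ => ?_
              refine (mul_le_mul_of_nonneg_right (abs_add_le _ _) hb).trans_eq ?_
              rw [add_mul]
              split_ifs <;> simp
          _ = b := by
              simp [Finset.sum_add_distrib]
              ring
  have h2 := (h1.square_stage (fun x hx k => ?_) m).linear (κ := Option κ)
    (fun o i => o.elim (i.elim 1 fun _ => 0)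
      (fun k => i.elim 0 (Sum.elim (fun _ => 0)
        fun j => if j.1 = k then (if j.2 then 1 else -1) else 0)))
  · refine h2.mono rfl ?_ ?_ ?_
    · simp only [Fintype.card_option, Fintype.card_prod, Fintype.card_bool]
      omega
    · rintro x - (_ | k)
      · simp [Fintype.sum_option, withOne]
      · simp [Fintype.sum_option, withOne, mulApprox, Fintype.sum_prod_type]
        ring
    · rintro (_ | k)
      · simp [Fintype.sum_option, boundOne]
      · simp [Fintype.sum_option, boundOne, Fintype.sum_prod_type, apply_ite abs,
          Finset.sum_add_distrib]
        have : 0 ≤ (b + 1) * ((2 : ℝ) ^ m)⁻¹ := by positivity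
        nlinarith
  · obtain ⟨k, β⟩ := k
    cases β
    · simpa using abs_half_sub_le (hv x hx _) (hv x hx _)
    · simpa using abs_half_add_le (hv x hx _) (hv x hx _)

/-- Each level multiplies the pairs of factors that differ in the first bit. The row sums follow `b
↦ 4b + 2`, and `4b + 3 ≤ 4 (b + 1)` makes `b + 1` the convenient quantity to iterate. -/
theorem Realizes.prod_approx (m q : ℕ) {v : ι × (Fin q → Bool) → (Fin n → ℝ) → ℝ} {b : ℝ}
    (hb : 0 ≤ b) (h : Realizes S L w (withOne v) (boundOne b))
    (hv : ∀ x ∈ S, ∀ k, |v k x| ≤ 1) :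
    ∃ u : ι → (Fin n → ℝ) → ℝ,
      Realizes S (L + q * (m + 1)) (max w (1 + 4 * (Fintype.card ι * 2 ^ q)))
        (withOne u) (boundOne (4 ^ q * (b + 1))) ∧
      ∀ x ∈ S, ∀ i, |u i x| ≤ 1 ∧ |u i x - ∏ σ, v (i, σ) x| ≤ 2 ^ q * (1 / 4) ^ m := by
  classical
  induction q generalizing L w b with
  | zero =>
    refine ⟨fun i => v (i, fun _ => false), ?_, fun x hx i => ⟨hv x hx _, ?_⟩⟩
    · refine (h.linear (κ := Option ι) (fun o i => o.elim (i.elim 1 fun _ => 0)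
        (fun k => i.elim 0 fun j => if j = (k, fun _ => false) then 1 else 0))).mono (by simp) ?_ ?_ ?_
      · simp only [Fintype.card_option]
        omega
      · rintro x - (_ | k)
        · simp [Fintype.sum_option, withOne]
        · simp only [Fintype.sum_option, withOne, Option.elim_none, Option.elim_some, zero_mul,
            zero_add]
          rw [Fintype.sum_eq_single (k, fun _ => false) fun j hj => by rw [if_neg hj, zero_mul],
            if_pos rfl, one_mul]
      · rintro (_ | k)
        · simp [Fintype.sum_option, boundOne]
        · simp only [Fintype.sum_option, boundOne, Option.elim_none, Option.elim_some, abs_zero,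
            zero_mul, zero_add]
          rw [Fintype.sum_eq_single (k, fun _ => false) fun j hj => by
            rw [if_neg hj, abs_zero, zero_mul], if_pos rfl]
          simp
    · rw [Fintype.prod_subsingleton _ fun _ => false]
      simp
  | succ q ih =>
    let v' : ι × (Fin q → Bool) → (Fin n → ℝ) → ℝ := fun k x =>
      mulApprox m (v (k.1, Fin.cons true k.2) x) (v (k.1, Fin.cons false k.2) x)
    have h1 : Realizes S (L + (m + 1)) _ (withOne v') _ := h.mul_approx hb hv
      (fun k : ι × (Fin q → Bool) => (k.1, Fin.cons true k.2)) (fun k => (k.1, Fin.cons false k.2)) m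
    have hv' : ∀ x ∈ S, ∀ k, |v' k x| ≤ 1 := fun x hx k =>
      abs_mulApprox_le (hv x hx _) (hv x hx _) m
    obtain ⟨u, hu, hu'⟩ := ih (by linarith) h1 hv'
    refine ⟨u, hu.mono (by ring) ?_ (fun _ _ _ => rfl) ?_, fun x hx i => ⟨(hu' x hx i).1, ?_⟩⟩
    · simp only [Fintype.card_prod, Fintype.card_fun, Fintype.card_bool, Fintype.card_fin, pow_succ]
      have : Fintype.card ι * (2 ^ q * 2) = 2 * (Fintype.card ι * 2 ^ q) := by ring
      omega
    · rintro (_ | k)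
      · exact le_rfl
      · simp only [boundOne, Option.elim_some, pow_succ, mul_assoc]
        gcongr
        linarith
    · have hp : ∏ σ, v (i, σ) x =
          ∏ σ : Fin q → Bool, v (i, Fin.cons true σ) x * v (i, Fin.cons false σ) x := by
        rw [← (Fin.consEquiv fun _ => Bool).prod_comp, Fintype.prod_prod_type, Fintype.prod_bool,
          ← Finset.prod_mul_distrib]
        rfl
      have hq : |∏ σ, v' (i, σ) x - ∏ σ, v (i, σ) x| ≤ 2 ^ q * (1 / 4) ^ m := by
        rw [hp]
        refine (abs_prod_sub_prod_le _ (fun σ _ => hv' x hx (i, σ)) fun σ _ => ?_).trans ?_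
        · rw [abs_mul]
          exact mul_le_one₀ (hv x hx _) (abs_nonneg _) (hv x hx _)
        · refine (Finset.sum_le_card_nsmul _ _ _ fun σ _ =>
            abs_mulApprox_sub_le (hv x hx _) (hv x hx _) m).trans_eq ?_
          simp
      calc _ ≤ |u i x - ∏ σ, v' (i, σ) x| + |∏ σ, v' (i, σ) x - ∏ σ, v (i, σ) x| :=
            abs_sub_le _ _ _
        _ ≤ 2 ^ q * (1 / 4) ^ m + 2 ^ q * (1 / 4) ^ m := add_le_add (hu' x hx i).2 hq
        _ = _ := by ring

end

end Network

/-! ### Interpolation at roots of unity -/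

/-- The `k`-th coefficient of the polynomial of degree less than `n` that interpolates `φ` at the
`n`-th roots of unity. -/
noncomputable def interpCoeff (n : ℕ) (φ : ℂ → ℂ) (k : ℕ) : ℂ :=
  (n : ℂ)⁻¹ * ∑ j ∈ Finset.range n, φ (Complex.exp (2 * Real.pi * Complex.I / n) ^ j) *
    ((Complex.exp (2 * Real.pi * Complex.I / n) ^ j) ^ k)⁻¹

theorem norm_root_pow {n : ℕ} (hn : n ≠ 0) (j : ℕ) :
    ‖Complex.exp (2 * Real.pi * Complex.I / n) ^ j‖ = 1 := by
  rw [norm_pow, (Complex.isPrimitiveRoot_exp n hn).norm'_eq_one hn, one_pow]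

theorem norm_interpCoeff_le {n : ℕ} (hn : n ≠ 0) {φ : ℂ → ℂ} {F : ℝ}
    (hφ : ∀ z, ‖z‖ = 1 → ‖φ z‖ ≤ F) (k : ℕ) : ‖interpCoeff n φ k‖ ≤ F := by
  have hn' : (0 : ℝ) < n := by positivity
  rw [interpCoeff, norm_mul, norm_inv, Complex.norm_natCast, inv_mul_le_iff₀ hn']
  refine (norm_sum_le_of_le _ fun j _ => ?_).trans_eq (b := ∑ j ∈ Finset.range n, F) (by simp)
  rw [norm_mul, norm_inv, norm_pow (_ ^ j), norm_root_pow hn, one_pow, inv_one, mul_one]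
  exact hφ _ (norm_root_pow hn j)

theorem interpCoeff_sub (n : ℕ) (φ ψ : ℂ → ℂ) (k : ℕ) :
    interpCoeff n (fun z => φ z - ψ z) k = interpCoeff n φ k - interpCoeff n ψ k := by
  simp only [interpCoeff, sub_mul, Finset.sum_sub_distrib, mul_sub]

theorem interpCoeff_pow {n k l : ℕ} (hk : k < n) (hl : l < n) :
    interpCoeff n (fun z => z ^ l) k = if l = k then 1 else 0 := by
  have hn : n ≠ 0 := by omega
  have hω := Complex.isPrimitiveRoot_exp n hn
  set ω := Complex.exp (2 * Real.pi * Complex.I / n)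
  have h0 : ω ≠ 0 := hω.ne_zero hn
  have h1 : ∀ j ∈ Finset.range n, (ω ^ j) ^ l * ((ω ^ j) ^ k)⁻¹ = (ω ^ l * (ω ^ k)⁻¹) ^ j := by
    intro j _
    rw [mul_pow, inv_pow, ← pow_mul, ← pow_mul, ← pow_mul, ← pow_mul, mul_comm j, mul_comm j]
  rw [interpCoeff, Finset.sum_congr rfl h1]
  split_ifs with h
  · rw [h, mul_inv_cancel₀ (pow_ne_zero _ h0)]
    simp [hn]
  · have h2 : ω ^ l * (ω ^ k)⁻¹ ≠ 1 := fun h3 => h <| hω.pow_inj hl hk <| by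
      rwa [mul_inv_eq_one₀ (pow_ne_zero _ h0)] at h3
    have h3 : (ω ^ l * (ω ^ k)⁻¹) ^ n = 1 := by
      rw [mul_pow, inv_pow, ← pow_mul, ← pow_mul, mul_comm l, mul_comm k, pow_mul, pow_mul,
        hω.pow_eq_one]
      simp
    have h4 := mul_geom_sum (ω ^ l * (ω ^ k)⁻¹) n
    rw [h3, sub_self] at h4
    rw [(mul_eq_zero.1 h4).resolve_left (sub_ne_zero.2 h2), mul_zero]

theorem interpCoeff_sum {n k : ℕ} (hk : k < n) (a : ℕ → ℂ) :
    interpCoeff n (fun z => ∑ l ∈ Finset.range n, a l * z ^ l) k = a k := by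
  have h : interpCoeff n (fun z => ∑ l ∈ Finset.range n, a l * z ^ l) k =
      ∑ l ∈ Finset.range n, a l * interpCoeff n (fun z => z ^ l) k := by
    simp only [interpCoeff, Finset.sum_mul, Finset.mul_sum]
    rw [Finset.sum_comm]
    exact Finset.sum_congr rfl fun _ _ => Finset.sum_congr rfl fun _ _ => by ring
  rw [h, Finset.sum_congr rfl fun l hl => by rw [interpCoeff_pow hk (Finset.mem_range.1 hl)]]
  simp [hk]

/-- Cauchy's estimate on the circle of radius `11/10 < 9/8` bounds the Taylor coefficients; `11 = 1
/ (1 - 10/11)` comes from the geometric tail. -/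
theorem exists_taylor_bound {φ : ℂ → ℂ} {F : ℝ}
    (hd : DifferentiableOn ℂ φ (Metric.ball 0 (9 / 8)))
    (hF : ∀ z ∈ Metric.ball (0 : ℂ) (9 / 8), ‖φ z‖ ≤ F) (n : ℕ) :
    ∃ a : ℕ → ℂ, ∀ z : ℂ, ‖z‖ ≤ 1 →
      ‖φ z - ∑ l ∈ Finset.range n, a l * z ^ l‖ ≤ 11 * F * (10 / 11) ^ n := by
  let a : ℕ → ℂ := fun l => (l.factorial : ℂ)⁻¹ * iteratedDeriv l φ 0
  have ha : ∀ l, ‖a l‖ ≤ F * (10 / 11) ^ l := fun l => by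
    have hs : Metric.closedBall (0 : ℂ) (11 / 10) ⊆ Metric.ball 0 (9 / 8) :=
      Metric.closedBall_subset_ball (by norm_num)
    have h1 := Complex.norm_iteratedDeriv_le_of_forall_mem_sphere_norm_le (c := (0 : ℂ))
      (R := 11 / 10) (C := F) l (by norm_num)
      ((hd.mono hs).diffContOnCl_ball subset_rfl)
      fun z hz => hF z (hs (Metric.sphere_subset_closedBall hz))
    simp only [a]
    rw [norm_mul, norm_inv, Complex.norm_natCast, inv_mul_le_iff₀ (by positivity)]
    refine h1.trans_eq ?_
    rw [show (10 / 11 : ℝ) = (11 / 10)⁻¹ by norm_num, inv_pow, div_eq_mul_inv, mul_assoc]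
  refine ⟨a, fun z hz => ?_⟩
  have hz' : z ∈ Metric.ball (0 : ℂ) (9 / 8) := by
    rw [mem_ball_zero_iff]
    linarith
  have h1 : HasSum (fun l => a l * z ^ l) (φ z) := by
    have := Complex.hasSum_taylorSeries_on_ball hd hz'
    refine this.congr_fun fun l => ?_
    simp only [a, smul_eq_mul, sub_zero]
    ring
  have hF0 : 0 ≤ F := (norm_nonneg _).trans (hF z hz')
  have h2 : ∀ l, ‖a l * z ^ l‖ ≤ F * (10 / 11) ^ l := fun l => by
    rw [norm_mul, norm_pow]
    exact (mul_le_of_le_one_right (norm_nonneg _) (pow_le_one₀ (norm_nonneg _) hz)).trans (ha l)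
  have h3 := norm_sub_le_of_geometric_bound_of_hasSum (r := 10 / 11) (by norm_num) h2 h1 n
  rw [norm_sub_rev]
  refine h3.trans_eq ?_
  ring

/-- Interpolation reproduces the Taylor polynomial, so the coefficients differ from Taylor's by
those of the interpolated remainder. This gives `n` errors, plus the remainder itself. -/
theorem norm_sub_interp_le {φ : ℂ → ℂ} {F : ℝ} {n : ℕ} (hn : n ≠ 0)
    (hd : DifferentiableOn ℂ φ (Metric.ball 0 (9 / 8)))
    (hF : ∀ z ∈ Metric.ball (0 : ℂ) (9 / 8), ‖φ z‖ ≤ F) {z : ℂ} (hz : ‖z‖ ≤ 1) :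
    ‖φ z - ∑ k : Fin n, interpCoeff n φ k * z ^ (k : ℕ)‖ ≤
      (n + 1) * (11 * F * (10 / 11) ^ n) := by
  obtain ⟨a, ha⟩ := exists_taylor_bound hd hF n
  have h1 : ∀ k : Fin n, ‖interpCoeff n φ k - a k‖ ≤ 11 * F * (10 / 11) ^ n := fun k => by
    rw [← interpCoeff_sum k.2 a, ← interpCoeff_sub]
    exact norm_interpCoeff_le hn (fun z hz => ha z hz.le) k
  have h2 : φ z - ∑ k : Fin n, interpCoeff n φ k * z ^ (k : ℕ) =
      (φ z - ∑ l ∈ Finset.range n, a l * z ^ l) -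
        ∑ k : Fin n, (interpCoeff n φ k - a k) * z ^ (k : ℕ) := by
    rw [Finset.sum_range fun l => a l * z ^ l]
    simp only [sub_mul, Finset.sum_sub_distrib]
    ring
  rw [h2]
  refine (norm_sub_le _ _).trans ?_
  have h3 : ‖∑ k : Fin n, (interpCoeff n φ k - a k) * z ^ (k : ℕ)‖ ≤
      ∑ _k : Fin n, 11 * F * (10 / 11) ^ n := norm_sum_le_of_le _ fun k _ => by
    rw [norm_mul, norm_pow]
    exact (mul_le_of_le_one_right (norm_nonneg _) (pow_le_one₀ (norm_nonneg _) hz)).trans (h1 k)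
  refine (add_le_add (ha z hz) h3).trans_eq ?_
  simp
  ring

/-- Tensor product interpolation at roots of unity of a function that is holomorphic on the
polydisc of radius `9 / 8`. -/
theorem exists_polynomial_approx {n : ℕ} (hn : n ≠ 0) {F : ℝ} (d : ℕ) {G : (Fin d → ℂ) → ℂ}
    (hd : DifferentiableOn ℂ G {u | ∀ i, ‖u i‖ < 9 / 8})
    (hF : ∀ u, (∀ i, ‖u i‖ < 9 / 8) → ‖G u‖ ≤ F) :
    ∃ c : (Fin d → Fin n) → ℂ, (∀ α, ‖c α‖ ≤ F) ∧ ∀ u, (∀ i, ‖u i‖ ≤ 1) →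
      ‖G u - ∑ α, c α * ∏ i, u i ^ (α i : ℕ)‖ ≤
        d * n ^ d * ((n + 1) * (11 * F * (10 / 11) ^ n)) := by
  have hF0 : 0 ≤ F := (norm_nonneg _).trans (hF 0 fun i => by simp)
  have hn1 : (1 : ℝ) ≤ n := by exact_mod_cast Nat.one_le_iff_ne_zero.2 hn
  induction d with
  | zero =>
    refine ⟨fun _ => G 0, fun _ => hF 0 fun i => i.elim0, fun u _ => ?_⟩
    rw [Subsingleton.elim u 0]
    simp
  | succ d ih =>
    have hcons : ∀ {z : ℂ} {u : Fin d → ℂ} {r : ℝ}, ‖z‖ < r → (∀ i, ‖u i‖ < r) →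
        ∀ i, ‖(Fin.cons z u : Fin (d + 1) → ℂ) i‖ < r := fun hz hu i => by
      cases i using Fin.cases with
      | zero => exact hz
      | succ i => exact hu i
    -- A coefficient in the first variable is a finite combination of slices of `G`, hence
    -- holomorphic in the other variables and still bounded by `F`.
    have hc : ∀ k : Fin n, ∃ c : (Fin d → Fin n) → ℂ, (∀ α, ‖c α‖ ≤ F) ∧
        ∀ u, (∀ i, ‖u i‖ ≤ 1) →
        ‖interpCoeff n (fun z => G (Fin.cons z u)) k - ∑ α, c α * ∏ i, u i ^ (α i : ℕ)‖ ≤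
          d * n ^ d * ((n + 1) * (11 * F * (10 / 11) ^ n)) := fun k => by
      refine ih (G := fun u => interpCoeff n (fun z => G (Fin.cons z u)) k) ?_ fun u hu =>
        norm_interpCoeff_le hn (fun z hz => hF _ (hcons (by rw [hz]; norm_num) hu)) k
      refine DifferentiableOn.const_mul (DifferentiableOn.fun_sum fun j _ =>
        DifferentiableOn.mul_const (hd.comp (Differentiable.differentiableOn ?_) fun u hu =>
          hcons (by rw [norm_root_pow hn]; norm_num) hu) _) _
      refine differentiable_pi.2 fun i => ?_
      cases i using Fin.cases with
      | zero => simp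
      | succ i => simpa using differentiable_apply i
    choose c hc1 hc2 using hc
    refine ⟨fun α => c (α 0) (Fin.tail α), fun α => hc1 _ _, fun u hu => ?_⟩
    set δ : ℝ := (n + 1) * (11 * F * (10 / 11) ^ n)
    have hδ : 0 ≤ δ := by positivity
    have hu' : ∀ i, ‖Fin.tail u i‖ ≤ 1 := fun i => hu _
    have h1 : ‖G u - ∑ k : Fin n, interpCoeff n (fun z => G (Fin.cons z (Fin.tail u))) k *
        u 0 ^ (k : ℕ)‖ ≤ δ := by
      have := norm_sub_interp_le (φ := fun z => G (Fin.cons z (Fin.tail u))) (F := F) hn ?_ ?_ (hu 0)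
      · simpa using this
      · refine hd.comp (Differentiable.differentiableOn (differentiable_pi.2 fun i => ?_))
          fun z hz => hcons (mem_ball_zero_iff.1 hz) fun i => (hu' i).trans_lt (by norm_num)
        cases i using Fin.cases with
        | zero => simp
        | succ i => simp
      · exact fun z hz => hF _ (hcons (mem_ball_zero_iff.1 hz)
          fun i => (hu' i).trans_lt (by norm_num))
    have h2 : ∑ α : Fin (d + 1) → Fin n, c (α 0) (Fin.tail α) * ∏ i, u i ^ (α i : ℕ) =
        ∑ k : Fin n, (∑ β, c k β * ∏ i, Fin.tail u i ^ (β i : ℕ)) * u 0 ^ (k : ℕ) := by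
      rw [← (Fin.consEquiv fun _ => Fin n).sum_comp, Fintype.sum_prod_type]
      refine Finset.sum_congr rfl fun k _ => ?_
      rw [Finset.sum_mul]
      refine Finset.sum_congr rfl fun β _ => ?_
      simp [Fin.consEquiv, Fin.prod_univ_succ, Fin.tail]
      ring
    have h3 : ‖∑ k : Fin n, (interpCoeff n (fun z => G (Fin.cons z (Fin.tail u))) k -
        ∑ β, c k β * ∏ i, Fin.tail u i ^ (β i : ℕ)) * u 0 ^ (k : ℕ)‖ ≤
        ∑ _k : Fin n, d * n ^ d * δ := norm_sum_le_of_le _ fun k _ => by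
      rw [norm_mul, norm_pow]
      exact (mul_le_of_le_one_right (norm_nonneg _) (pow_le_one₀ (norm_nonneg _) (hu 0))).trans
        (hc2 k _ hu')
    rw [h2]
    calc _ = ‖(G u - ∑ k : Fin n, interpCoeff n (fun z => G (Fin.cons z (Fin.tail u))) k *
            u 0 ^ (k : ℕ)) + ∑ k : Fin n, (interpCoeff n (fun z => G (Fin.cons z (Fin.tail u))) k -
            ∑ β, c k β * ∏ i, Fin.tail u i ^ (β i : ℕ)) * u 0 ^ (k : ℕ)‖ := by
          simp only [sub_mul, Finset.sum_sub_distrib]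
          congr 1
          ring
      _ ≤ δ + ∑ _k : Fin n, d * n ^ d * δ := (norm_add_le _ _).trans (add_le_add h1 h3)
      _ = δ + d * n ^ (d + 1) * δ := by
          simp
          ring
      _ ≤ n ^ (d + 1) * δ + d * n ^ (d + 1) * δ := by
          gcongr
          exact le_mul_of_one_le_left hδ (one_le_pow₀ hn1)
      _ = _ := by
          push_cast
          ring

/-! ### The polydisc inside the region of analyticity -/

/-- If `h = (ρ - ρ⁻¹) / 2` and `ρ ≥ 2 ^ √d`, then `h² ≥ (log 2)² d`. -/
theorem log_two_sq_mul_le {d : ℕ} {ρ : ℝ} (hρ : (2 : ℝ) ^ Real.sqrt (d : ℝ) ≤ ρ) :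
    Real.log 2 ^ 2 * d ≤ ((ρ - ρ⁻¹) / 2) ^ 2 := by
  have h0 : (0 : ℝ) < 2 ^ Real.sqrt (d : ℝ) := by positivity
  have hρ0 : 0 < ρ := h0.trans_le hρ
  have h1 : Real.sqrt d * Real.log 2 ≤ Real.log ρ := by
    rw [← Real.log_rpow two_pos]
    exact Real.log_le_log h0 hρ
  have h2 : 0 ≤ Real.sqrt d * Real.log 2 :=
    mul_nonneg (Real.sqrt_nonneg _) (Real.log_nonneg one_le_two)
  -- The right side is `sinh (log ρ)`.
  have h3 : Real.log ρ ≤ (ρ - ρ⁻¹) / 2 := by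
    have := Real.self_le_sinh_iff.2 (h2.trans h1)
    rwa [Real.sinh_log hρ0] at this
  calc _ = (Real.sqrt d * Real.log 2) ^ 2 := by rw [mul_pow, Real.sq_sqrt d.cast_nonneg, mul_comm]
    _ ≤ _ := pow_le_pow_left₀ h2 (h1.trans h3) 2

/-- Weighted AM-GM for `|z - 1| |z + 1|`, with weight `3` chosen for equality at `z = 1/2`. -/
theorem norm_sq_add_norm_sq_sub_one_le (z : ℂ) :
    ‖z ^ 2‖ + ‖z ^ 2 - 1‖ ≤ 1 + 8 / 3 * ‖z - 1 / 2‖ ^ 2 := by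
  have h1 : ‖z ^ 2 - 1‖ = ‖z - 1‖ * ‖z + 1‖ := by
    rw [← norm_mul]
    ring_nf
  have h2 : ‖z‖ ^ 2 = z.re * z.re + z.im * z.im := by rw [Complex.sq_norm, Complex.normSq_apply]
  have h3 : ‖z - 1‖ ^ 2 = (z.re - 1) * (z.re - 1) + z.im * z.im := by
    rw [Complex.sq_norm, Complex.normSq_apply]
    simp
  have h4 : ‖z + 1‖ ^ 2 = (z.re + 1) * (z.re + 1) + z.im * z.im := by
    rw [Complex.sq_norm, Complex.normSq_apply]
    simp
  have h5 : ‖z - 1 / 2‖ ^ 2 = (z.re - 1 / 2) * (z.re - 1 / 2) + z.im * z.im := by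
    rw [Complex.sq_norm, Complex.normSq_apply]
    simp
  rw [h1, norm_pow, h2, h5]
  nlinarith [sq_nonneg (3 * ‖z - 1‖ - ‖z + 1‖)]

theorem half_add_mem_analyticRegion {d : ℕ} (hd : 1 ≤ d) {ρ : ℝ}
    (hρ : (2 : ℝ) ^ Real.sqrt (d : ℝ) ≤ ρ) {u : Fin d → ℂ} (hu : ∀ i, ‖u i‖ < 9 / 8) :
    (fun i => (1 + u i) / 2) ∈ analyticRegion d ρ := by
  have h1 := log_two_sq_mul_le hρ
  have hd0 : (0 : ℝ) < d := by exact_mod_cast hd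
  -- What is needed is `1 + 2 (log 2)² > 59/32`, where `59/32 = 1 + 8/3 * (9/16)²`.
  have h2 : (0.48 : ℝ) < Real.log 2 ^ 2 := by nlinarith [Real.log_two_gt_d9]
  have h3 : ∀ i, ‖((1 + u i) / 2) ^ 2‖ + ‖((1 + u i) / 2) ^ 2 - 1‖ ≤ 59 / 32 := fun i => by
    have h4 := norm_sq_add_norm_sq_sub_one_le ((1 + u i) / 2)
    have h5 : (1 + u i) / 2 - 1 / 2 = u i / 2 := by ring
    rw [h5, norm_div, Complex.norm_ofNat] at h4
    nlinarith [hu i, norm_nonneg (u i)]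
  change ‖_‖ + ‖_‖ < _
  have h6 : ∑ i, ((1 + u i) / 2) ^ 2 - ((d : ℝ) : ℂ) = ∑ i, (((1 + u i) / 2) ^ 2 - 1) := by simp
  rw [h6]
  calc _ ≤ ∑ i, ‖((1 + u i) / 2) ^ 2‖ + ∑ i, ‖((1 + u i) / 2) ^ 2 - 1‖ :=
        add_le_add (norm_sum_le _ _) (norm_sum_le _ _)
    _ ≤ ∑ _i : Fin d, (59 / 32 : ℝ) := by
        rw [← Finset.sum_add_distrib]
        exact Finset.sum_le_sum fun i _ => h3 i
    _ = d * (59 / 32) := by simp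
    _ < _ := by nlinarith

theorem AnalyticClass.exists_polynomial_approx {d : ℕ} (hd : 1 ≤ d) {ρ F : ℝ}
    (hρ : (2 : ℝ) ^ Real.sqrt (d : ℝ) ≤ ρ) {f : (Fin d → ℝ) → ℝ} (hf : f ∈ AnalyticClass d ρ F)
    {n : ℕ} (hn : n ≠ 0) :
    ∃ c : (Fin d → Fin n) → ℝ, (∀ α, |c α| ≤ F) ∧ ∀ x ∈ Set.Icc (0 : Fin d → ℝ) 1,
      |∑ α, c α * ∏ i, (2 * x i - 1) ^ (α i : ℕ) - f x| ≤
        d * n ^ d * ((n + 1) * (11 * F * (10 / 11) ^ n)) := by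
  obtain ⟨g, hg, hF, hgf⟩ := hf
  obtain ⟨c, hc1, hc2⟩ := _root_.exists_polynomial_approx hn (F := F) d
    (G := fun u => g fun i => (1 + u i) / 2)
    (hg.differentiableOn.comp (Differentiable.differentiableOn (by fun_prop))
      fun u hu => half_add_mem_analyticRegion hd hρ hu)
    fun u hu => hF _ (half_add_mem_analyticRegion hd hρ hu)
  refine ⟨fun α => (c α).re, fun α => (Complex.abs_re_le_norm _).trans (hc1 α), fun x hx => ?_⟩
  have h1 := hc2 (fun i => ((2 * x i - 1 : ℝ) : ℂ)) fun i => by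
    rw [Complex.norm_real, Real.norm_eq_abs, abs_le]
    have h3 := hx.1 i
    have h4 := hx.2 i
    simp only [Pi.zero_apply, Pi.one_apply] at h3 h4
    constructor <;> linarith
  have h2 : (fun i => (1 + ((2 * x i - 1 : ℝ) : ℂ)) / 2) = fun i => (x i : ℂ) := by
    funext i
    push_cast
    ring
  simp only [h2, hgf x hx] at h1
  rw [abs_sub_comm]
  refine le_trans ?_ ((Complex.abs_re_le_norm _).trans h1)
  apply le_of_eq
  congr 1
  rw [Complex.sub_re, Complex.ofReal_re, Complex.re_sum]
  congr 1
  refine Finset.sum_congr rfl fun α _ => ?_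
  rw [← Complex.re_mul_ofReal]
  push_cast
  rfl

/-! ### The network for a polynomial -/

namespace Network

theorem exists_polynomial_approx {d n q : ℕ} (m : ℕ) (hq : d * n ≤ 2 ^ q) {F : ℝ} (hF0 : 0 ≤ F)
    {c : (Fin d → Fin n) → ℝ} (hc : ∀ α, |c α| ≤ F) :
    ∃ N : Network (d + 1) 1, N.depth = q * (m + 1) ∧
      N.maxWidth ≤ d + 2 + 4 * (n ^ d * 2 ^ q) ∧
      N.crossNorm ≤ n ^ d * (F * (4 ^ q * 4)) ∧
      ∀ x ∈ Set.Icc (0 : Fin d → ℝ) 1,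
        |N.eval (fun t => |t|) (Fin.cons 1 x) 0 - ∑ α, c α * ∏ i, (2 * x i - 1) ^ (α i : ℕ)| ≤
          n ^ d * (F * (2 ^ q * (1 / 4) ^ m)) := by
  classical
  -- Slot `(i, j)` holds `2 x_i - 1` if `j < α i` and `1` otherwise; leaves outside the range of `e`
  -- also hold `1`.
  obtain ⟨e⟩ : Nonempty (Fin d × Fin n ↪ (Fin q → Bool)) :=
    Function.Embedding.nonempty_of_card_le (by simpa using hq)
  let S : Set (Fin (d + 1) → ℝ) := Fin.cons 1 '' Set.Icc (0 : Fin d → ℝ) 1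
  let row : (Fin d → Fin n) → Fin d × Fin n → Fin (d + 1) → ℝ := fun α l =>
    if l.2 < α l.1 then Fin.cons (-1) (fun j => if j = l.1 then 2 else 0) else Fin.cons 1 0
  let W : (Fin d → Fin n) × (Fin q → Bool) → Fin (d + 1) → ℝ := fun k =>
    Function.extend e (row k.1) (fun _ => Fin.cons 1 0) k.2
  let v : (Fin d → Fin n) × (Fin q → Bool) → (Fin (d + 1) → ℝ) → ℝ := fun k X => ∑ j, W k j * X j
  have hrow : ∀ α l x, ∑ j, row α l j * (Fin.cons 1 x : Fin (d + 1) → ℝ) j =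
      if l.2 < α l.1 then 2 * x l.1 - 1 else 1 := fun α l x => by
    simp only [row]
    split_ifs
    · simp [Fin.sum_univ_succ]
      ring
    · simp [Fin.sum_univ_succ]
  have hv : ∀ X ∈ S, ∀ k, |v k X| ≤ 1 := by
    rintro _ ⟨x, hx, rfl⟩ ⟨α, σ⟩
    by_cases h : ∃ l, e l = σ
    · obtain ⟨l, rfl⟩ := h
      simp only [v, W, e.injective.extend_apply, hrow]
      have h3 := hx.1 l.1
      have h4 := hx.2 l.1
      simp only [Pi.zero_apply, Pi.one_apply] at h3 h4
      split_ifs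
      · rw [abs_le]
        constructor <;> linarith
      · simp
    · simp only [v, W, Function.extend_apply' _ _ _ h]
      simp [Fin.sum_univ_succ]
  have hprod : ∀ x α, ∏ σ, v (α, σ) (Fin.cons 1 x) = ∏ i, (2 * x i - 1) ^ (α i : ℕ) := by
    intro x α
    rw [← Fintype.prod_of_injective e e.injective
      (fun l => if l.2 < α l.1 then 2 * x l.1 - 1 else 1)]
    · rw [Fintype.prod_prod_type]
      refine Finset.prod_congr rfl fun i _ => ?_
      rw [Finset.prod_ite]
      simp [Finset.filter_gt_eq_Iio]
    · intro σ hσ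
      simp only [v, W, Function.extend_apply' _ _ _ hσ]
      simp [Fin.sum_univ_succ]
    · intro l
      simp only [v, W, e.injective.extend_apply, hrow]
  -- The `3` is `|-1| + |2|`, from the row computing `2 x_i - 1`.
  have h1 : Realizes S 0 (max (d + 1) (1 + n ^ d * 2 ^ q)) (withOne v) (boundOne 3) := by
    refine (Realizes.input S (κ := Option ((Fin d → Fin n) × (Fin q → Bool)))
      (fun o => o.elim (Fin.cons 1 0) W)).mono rfl ?_ ?_ ?_
    · simp only [Fintype.card_option, Fintype.card_prod, Fintype.card_fun, Fintype.card_bool,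
        Fintype.card_fin]
      omega
    · rintro _ ⟨x, hx, rfl⟩ (_ | k)
      · simp [withOne, Fin.sum_univ_succ]
      · rfl
    · rintro (_ | ⟨α, σ⟩)
      · simp [boundOne, Fin.sum_univ_succ]
      · simp only [boundOne, Option.elim_some, W]
        by_cases h : ∃ l, e l = σ
        · obtain ⟨l, rfl⟩ := h
          simp only [e.injective.extend_apply, row]
          split_ifs
          · simp [Fin.sum_univ_succ, apply_ite abs]
            norm_num
          · simp [Fin.sum_univ_succ]
        · simp [Function.extend_apply' _ _ _ h, Fin.sum_univ_succ]
  obtain ⟨u, hu, hu'⟩ := h1.prod_approx m q (by norm_num) hv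
  obtain ⟨N, hN1, hN2, hN3, hN4⟩ :=
    (hu.linear (κ := Unit) fun _ i => i.elim 0 c).exists_network
  refine ⟨N, by simpa using hN1, hN2.trans ?_, hN4.trans ?_, fun x hx => ?_⟩
  · simp only [Fintype.card_fun, Fintype.card_fin, Fintype.card_unit]
    omega
  · simp only [Fintype.sum_option, Option.elim_none, Option.elim_some, abs_zero, zero_mul,
      zero_add, boundOne]
    refine (Finset.sum_le_sum fun α _ =>
      mul_le_mul_of_nonneg_right (hc α) (by positivity)).trans_eq ?_
    norm_num
  · have hx' : Fin.cons 1 x ∈ S := ⟨x, hx, rfl⟩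
    rw [hN3 _ hx']
    simp only [Fintype.sum_option, Option.elim_none, Option.elim_some, zero_mul, zero_add, withOne]
    rw [← Finset.sum_sub_distrib]
    refine (Finset.abs_sum_le_sum_abs _ _).trans ((Finset.sum_le_sum fun α _ =>
      (?_ : _ ≤ F * (2 ^ q * (1 / 4) ^ m))).trans_eq ?_)
    · rw [← mul_sub, abs_mul, ← hprod]
      exact mul_le_mul (hc α) (hu' _ hx' α).2 (abs_nonneg _) hF0
    · simp

end Network

/-! ### Choice of the parameters -/

theorem exists_pow_mul_half_pow_le (k : ℕ) : ∃ M : ℝ, ∀ t : ℕ, (t : ℝ) ^ k * (1 / 2) ^ t ≤ M := by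
  obtain ⟨M, hM⟩ := (tendsto_pow_const_div_const_pow_of_one_lt k one_lt_two).bddAbove_range
  refine ⟨M, fun t => ?_⟩
  have := hM ⟨t, rfl⟩
  rwa [one_div, inv_pow, ← div_eq_mul_inv]

theorem theorem2 (d : ℕ) (hd : 1 ≤ d) :
    ∃ K₁ K₂ : ℝ, ∀ ρ F : ℝ, (2 : ℝ) ^ Real.sqrt (d : ℝ) ≤ ρ → 0 < F →
      ∃ C K₃ : ℝ, ∀ f ∈ AnalyticClass d ρ F, ∀ ε ∈ Set.Ioo (0 : ℝ) 1,
        ∃ N : Network (d + 1) 1,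
          (N.depth : ℝ) ≤ K₁ * (max 1 (Real.logb 2 (1 / ε))) ^ 2 ∧
          (N.maxWidth : ℝ) ≤ K₂ * (max 1 (Real.logb 2 (1 / ε))) ^ (d + 2) ∧
          N.crossNorm ≤ K₃ * (max 1 (Real.logb 2 (1 / ε))) ^ (2 * d + 5) ∧
          ∀ x ∈ Set.Icc (0 : Fin d → ℝ) 1,
            |N.eval (fun t => |t|) (Fin.cons 1 x) 0 - f x| ≤ C * ε := by
  obtain ⟨M, hM⟩ := exists_pow_mul_half_pow_le (d + 1)
  refine ⟨256 * d, (d + 2 + 128 * d * 16 ^ d) * 2 ^ (d + 2), fun ρ F hρ hF =>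
    ⟨219 * d * 16 ^ d * F * M, 4096 * d ^ 2 * 16 ^ d * F * 2 ^ (2 * d + 5),
      fun f hf ε hε => ?_⟩⟩
  set ℓ : ℝ := max 1 (Real.logb 2 (1 / ε))
  have hℓ1 : 1 ≤ ℓ := le_max_left _ _
  set t : ℕ := ⌈ℓ⌉₊
  have ht : ℓ ≤ t := Nat.le_ceil _
  have ht1 : (1 : ℝ) ≤ t := hℓ1.trans ht
  have ht2 : (t : ℝ) ≤ 2 * ℓ := by
    have := Nat.ceil_lt_add_one (zero_le_one.trans hℓ1)
    linarith
  have ht0 : t ≠ 0 := by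
    rintro h
    rw [h] at ht1
    norm_num at ht1
  have hε' : (1 / 2 : ℝ) ^ t ≤ ε := by
    have h1 : Real.logb 2 (1 / ε) ≤ t := (le_max_right _ _).trans ht
    rw [Real.logb_le_iff_le_rpow one_lt_two (by have := hε.1; positivity), Real.rpow_natCast] at h1
    rw [one_div, inv_pow]
    exact inv_le_of_inv_le₀ hε.1 (by rwa [← one_div])
  have hpow : ∀ {j k : ℕ}, j ≤ k → (t : ℝ) ^ j ≤ 2 ^ k * ℓ ^ k := fun h => by
    rw [← mul_pow]
    exact (pow_le_pow_right₀ ht1 h).trans (pow_le_pow_left₀ (by positivity) ht2 _)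
  have hdn : d * (16 * t) ≠ 0 := by
    have : d ≠ 0 := by omega
    positivity
  set q : ℕ := Nat.log 2 (d * (16 * t)) + 1
  have hq1 : d * (16 * t) ≤ 2 ^ q := (Nat.lt_pow_succ_log_self one_lt_two _).le
  have hq2 : 2 ^ q ≤ 32 * d * t := by
    have := Nat.pow_log_le_self 2 hdn
    rw [pow_succ]
    linarith
  have hq3 : (2 : ℝ) ^ q ≤ 32 * d * t := by exact_mod_cast hq2
  -- The crude bound `q ≤ 2 ^ q` suffices, as quadratic depth is allowed.
  have hq4 : (q : ℝ) ≤ 32 * d * t := by exact_mod_cast Nat.lt_two_pow_self.le.trans hq2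
  obtain ⟨c, hc1, hc2⟩ :=
    AnalyticClass.exists_polynomial_approx hd hρ hf (n := 16 * t) (by omega)
  obtain ⟨N, hN1, hN2, hN3, hN4⟩ := Network.exists_polynomial_approx t hq1 hF.le hc1
  refine ⟨N, ?_, ?_, ?_, fun x hx => ?_⟩
  · rw [hN1]
    push_cast
    calc (q : ℝ) * (t + 1) ≤ 32 * d * t * (t + t) := by gcongr
      _ = 64 * d * t ^ 2 := by ring
      _ ≤ 64 * d * (2 ^ 2 * ℓ ^ 2) := by
          gcongr
          exact hpow le_rfl
      _ = _ := by ring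
  · calc (N.maxWidth : ℝ) ≤ d + 2 + 4 * ((16 * t) ^ d * 2 ^ q) := by exact_mod_cast hN2
      _ ≤ d + 2 + 4 * ((16 * t) ^ d * (32 * d * t)) := by gcongr
      _ = (d + 2) * t ^ 0 + 128 * d * 16 ^ d * t ^ (d + 1) := by ring
      _ ≤ (d + 2) * (2 ^ (d + 2) * ℓ ^ (d + 2)) +
            128 * d * 16 ^ d * (2 ^ (d + 2) * ℓ ^ (d + 2)) := by
          gcongr <;> exact hpow (by omega)
      _ = _ := by ring
  · calc N.crossNorm ≤ (16 * t) ^ d * (F * (4 ^ q * 4)) := by simpa using hN3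
      _ = (16 * t) ^ d * (F * ((2 ^ q) ^ 2 * 4)) := by
          rw [← pow_mul, mul_comm q, pow_mul]
          norm_num
      _ ≤ (16 * t) ^ d * (F * ((32 * d * t) ^ 2 * 4)) := by gcongr
      _ = 4096 * d ^ 2 * 16 ^ d * F * t ^ (d + 2) := by ring
      _ ≤ 4096 * d ^ 2 * 16 ^ d * F * (2 ^ (2 * d + 5) * ℓ ^ (2 * d + 5)) := by
          gcongr
          exact hpow (by omega)
      _ = _ := by ring
  -- Degree `16 t` matches the interpolation error to the `4⁻ᵗ` of the products. One factor `2⁻ᵗ`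
  -- then absorbs `t ^ (d + 1)` into `M`, the other is at most `ε`.
  · have h1 : (10 / 11 : ℝ) ^ (16 * t) ≤ (1 / 4) ^ t := by
      rw [pow_mul]
      exact pow_le_pow_left₀ (by positivity) (by norm_num) _
    have h2 := (abs_sub_le _ _ _).trans (add_le_add (hN4 x hx) (hc2 x hx))
    refine h2.trans ?_
    push_cast
    calc _ ≤ (16 * t : ℝ) ^ d * (F * (32 * d * t * (1 / 4) ^ t)) +
          d * (16 * t) ^ d * ((16 * t + t) * (11 * F * (1 / 4) ^ t)) := by gcongr
      _ = 219 * d * 16 ^ d * F * (t ^ (d + 1) * ((1 / 4) ^ t)) := by ring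
      _ = 219 * d * 16 ^ d * F * (t ^ (d + 1) * (1 / 2) ^ t) * (1 / 2) ^ t := by
          rw [show (1 / 4 : ℝ) = 1 / 2 * (1 / 2) by norm_num, mul_pow]
          ring
      _ ≤ 219 * d * 16 ^ d * F * M * ε := by
          have hM0 : 0 ≤ M := le_trans (by positivity) (hM t)
          gcongr
          exact hM t
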